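/- A reversible circuit on $n$ wires is a finite sequence of gates of the types NOT, CNOT and 2-CNOT (Toffoli), each acting on $\mathbb{Z}_2^n$: a gate with controlled wire $t$ and set of control wires $I$, $t\notin I$, $|I|\le 2$, replaces $x_t$ by $x_t\oplus\bigwedge_{i\in I}x_i$ and leaves the other coordinates unchanged (NOT is the case $I=\varnothing$). The complexity of a circuit is the number of its gates. A circuit on $n$ wires defining $g\colon\mathbb{Z}_2^n\to\mathbb{Z}_2^n$ realizes a map $f\colon\mathbb{Z}_2^n\to\mathbb{Z}_2^n$ without additional inputs if there is a permutation $\pi$ of the wires such that $f(x)_j=g(x)_{\pi(j)}$ for all $x$ and $j$. Let $L(n,0)$ be the maximum, over all maps $f$ that are realizable in this way, of the least complexity of a circuit realizing $f$. Theorem. Let $\phi\colon\mathbb{N}\to\mathbb{R}$ be any function with $\phi(n)\to\infty$ (growing arbitrarily slowly). Then there is a function $\delta(n)=o(1)$, with $\delta(n)\ge 0$ for all sufficiently large $n$, such that $$L(n,0)\le\frac{3n2^{n+4}}{\log_2 n-\log_2\log_2 n-\log_2\phi(n)}\,\bigl(1+\varepsilon(n)\bigr)$$ for every $n\ge 2$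 with $0<\phi(n)<n/\log_2 n$, where $$\varepsilon(n)=\frac{1}{6\phi(n)}+\left(\frac{8}{3}-\delta(n)\right)\frac{\log_2 n\cdot\log_2\log_2 n}{n},\qquad \varepsilon(n)\to 0.$$ -/

import Mathlib

open Filter Topology

namespace RevCircuit

/-- Binary vectors of length `n`. -/
abbrev BVec (n : ℕ) : Type := Fin n → ZMod 2

/-- A gate on `n` wires with at most two control inputs: no control input is NOT, one is CNOT,
two (distinct) ones are 2-CNOT (Toffoli). The controlled wire is never a control input. -/
structure Gate (n : ℕ) where
  target : Fin n
  controls : Finset (Fin n)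
  target_notMem : target ∉ controls
  card_le_two : controls.card ≤ 2

/-- The transformation defined by a gate: the controlled wire is flipped exactly when all control
wires carry the value `1` (over `ZMod 2` the product is the conjunction and the empty one is `1`). -/
def Gate.apply {n : ℕ} (g : Gate n) (x : BVec n) : BVec n :=
  Function.update x g.target (x g.target + ∏ i ∈ g.controls, x i)

/-- A reversible circuit on `n` wires: a finite sequence of gates connected one after another.
Its complexity is the number of its gates, that is `List.length`. -/
abbrev Circuit (n : ℕ) : Type := List (Gate n)

/-- The transformation defined by a circuit; the first gate of the list acts first. -/
def Circuit.eval {n : ℕ} (c : Circuit n) (x : BVec n) : BVec n :=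
  c.foldl (fun y g => g.apply y) x

/-- Feeding `0` to the `q` additional inputs. -/
def extend (n q : ℕ) (x : BVec n) : BVec (n + q) :=
  fun j => if h : (j : ℕ) < n then x ⟨j, h⟩ else 0

/-- The circuit realizes `f` with `q` additional inputs: for some permutation `π` of the outputs,
the value of `f` at `x` is read off the outputs `π 0, …, π (n - 1)` when `x` followed by `q` zeros
is the input. -/
def Realizes {n q : ℕ} (c : Circuit (n + q)) (f : BVec n → BVec n) : Prop :=
  ∃ π : Equiv.Perm (Fin (n + q)), ∀ (x : BVec n) (j : Fin n),
    c.eval (extend n q x) (π (Fin.castAdd q j)) = f x j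

/-- The set `F(n, q)` of the maps that circuits on `n + q` wires realize. -/
def realizableMaps (n q : ℕ) : Set (BVec n → BVec n) :=
  {f | ∃ c : Circuit (n + q), Realizes c f}

/-- `L(f, q)`: the least complexity of a circuit that realizes `f` with `q` additional inputs
(used for `f ∈ realizableMaps n q` only). -/
noncomputable def mapComplexity {n : ℕ} (f : BVec n → BVec n) (q : ℕ) : ℕ :=
  sInf {l | ∃ c : Circuit (n + q), Realizes c f ∧ c.length = l}

/-- The Shannon complexity function `L(n, q)`: the maximum of `L(f, q)` over `f ∈ F(n, q)`. -/
noncomputable def shannonComplexity (n q : ℕ) : ℕ :=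
  sSup ((fun f => mapComplexity f q) '' realizableMaps n q)

/-- For a realizable map the minimum is attained. -/
theorem mapComplexity_isLeast {n q : ℕ} {f : BVec n → BVec n} (hf : f ∈ realizableMaps n q) :
    IsLeast {l | ∃ c : Circuit (n + q), Realizes c f ∧ c.length = l} (mapComplexity f q) := by
  obtain ⟨c, hc⟩ := hf
  exact ⟨Nat.sInf_mem ⟨c.length, c, hc, rfl⟩, fun _ hl => Nat.sInf_le hl⟩

/-- The maximum in the Shannon function is attained: the supremum is never a default value. -/
theorem shannonComplexity_isGreatest (n q : ℕ) :
    IsGreatest ((fun f => mapComplexity f q) '' realizableMaps n q) (shannonComplexity n q) := by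
  have hfin : ((fun f => mapComplexity f q) '' realizableMaps n q).Finite :=
    (Set.toFinite (realizableMaps n q)).image _
  have hne : ((fun f => mapComplexity f q) '' realizableMaps n q).Nonempty := by
    refine ⟨_, id, ⟨[], Equiv.refl _, fun x j => ?_⟩, rfl⟩
    simp [Circuit.eval, extend]
  exact ⟨Nat.sSup_mem hne hfin.bddAbove, fun _ hl => le_csSup hfin.bddAbove hl⟩

/-- `ε(n) = 1 / (6 φ(n)) + (8/3 - δ(n)) · log₂ n · log₂ log₂ n / n`. -/
noncomputable def epsilon (φ δ : ℕ → ℝ) (n : ℕ) : ℝ :=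
  1 / (6 * φ n) + (8 / 3 - δ n) * (Real.logb 2 n * Real.logb 2 (Real.logb 2 n) / n)

end RevCircuit

/-! The saving comes from realizing `2 ^ m` disjoint transpositions at once. For `4 ≤ n` every gate
leaves a wire unused, which makes it a square of a permutation; hence circuits define even
permutations only, and it suffices to realize each even permutation cheaply.

The `2 ^ (m + 1)` points of a group form a matrix with `n` columns, of which at most `2 ^ 2 ^ (m +
1)` are distinct. One gate per repeated column, plus one negation per representative, makes the
repeated columns constant (`moves_compress`). The few remaining ones are cheap to rewrite, so about
`n` gates carry the points to a standard subcube (`moves_subcube`). There a single flip with about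
`n` controls, costing about `8 * n`, performs all the transpositions; undoing the motion costs
another `n` (`exists_circuit_pairing`).

An even permutation is peeled off in such groups until its support is below `3 * 2 ^ m`; pairs of
transpositions finish it (`computes_of_sign_eq_one`). With `2 ^ m` a constant fraction of `log₂ n`,
the cost is about `10 * n * 2 ^ (n - m)`, below `48 * n * 2 ^ n / log₂ n`. This beats the stated
main term as soon as `φ n ≥ 1`, so `δ = 0` works for large `n`. The finitely many other `n` are
absorbed by the free values of `δ`, except `n = 2`, where the coefficient of `δ` vanishes and a
count of permutations is used. -/

namespace RevCircuit

variable {n : ℕ}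

/-! ### Circuits as permutations -/

theorem Gate.apply_apply (g : Gate n) (x : BVec n) : g.apply (g.apply x) = x := by
  have h : ∏ i ∈ g.controls, g.apply x i = ∏ i ∈ g.controls, x i := by
    refine Finset.prod_congr rfl fun i hi => ?_
    have : i ≠ g.target := fun h => g.target_notMem (h ▸ hi)
    simp [Gate.apply, this]
  ext i
  by_cases hi : i = g.target
  · subst hi
    rw [Gate.apply, Function.update_self, h]
    simp [Gate.apply, add_assoc, CharTwo.add_self_eq_zero]
  · simp [Gate.apply, hi]

theorem Circuit.eval_nil (x : BVec n) : Circuit.eval [] x = x := rfl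

theorem Circuit.eval_cons (g : Gate n) (c : Circuit n) (x : BVec n) :
    Circuit.eval (g :: c) x = Circuit.eval c (g.apply x) := rfl

theorem Circuit.eval_append (c d : Circuit n) (x : BVec n) :
    Circuit.eval (c ++ d) x = Circuit.eval d (Circuit.eval c x) := by
  simp [Circuit.eval, List.foldl_append]

theorem Circuit.eval_reverse_eval (c : Circuit n) (x : BVec n) :
    Circuit.eval c.reverse (Circuit.eval c x) = x := by
  induction c generalizing x with
  | nil => rfl
  | cons g c ih =>
    rw [List.reverse_cons, eval_append, eval_cons g c, ih, eval_cons, eval_nil, Gate.apply_apply]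

theorem Circuit.eval_eval_reverse (c : Circuit n) (x : BVec n) :
    Circuit.eval c (Circuit.eval c.reverse x) = x := by
  simpa using Circuit.eval_reverse_eval c.reverse x

/-- The permutation of `BVec n` defined by a circuit. -/
def Circuit.perm (c : Circuit n) : Equiv.Perm (BVec n) where
  toFun := c.eval
  invFun := Circuit.eval c.reverse
  left_inv := c.eval_reverse_eval
  right_inv := c.eval_eval_reverse

theorem Circuit.perm_apply (c : Circuit n) (x : BVec n) : c.perm x = c.eval x := rfl

/-! ### Commutators of flips and parity -/

/-- The map flipping the wire `t` when all wires of `I` carry the value `1`. -/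
def flip (t : Fin n) (I : Finset (Fin n)) (x : BVec n) : BVec n :=
  Function.update x t (x t + ∏ i ∈ I, x i)

theorem flip_target (t : Fin n) (I : Finset (Fin n)) (x : BVec n) :
    flip t I x t = x t + ∏ i ∈ I, x i := by simp [flip]

theorem flip_of_ne {t i : Fin n} (I : Finset (Fin n)) (x : BVec n) (h : i ≠ t) :
    flip t I x i = x i := by simp [flip, h]

theorem prod_flip {t : Fin n} {I J : Finset (Fin n)} (h : t ∉ J) (x : BVec n) :
    ∏ i ∈ J, flip t I x i = ∏ i ∈ J, x i :=
  Finset.prod_congr rfl fun _ hi => flip_of_ne I x fun e => h (e ▸ hi)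

theorem flip_flip {t : Fin n} {I : Finset (Fin n)} (h : t ∉ I) (x : BVec n) :
    flip t I (flip t I x) = x := by
  ext i
  by_cases hi : i = t
  · subst hi
    rw [flip_target, prod_flip h, flip_target, add_assoc, CharTwo.add_self_eq_zero, add_zero]
  · rw [flip_of_ne _ _ hi, flip_of_ne _ _ hi]

/-- A flip with controls `A ∪ B` is the commutator of two smaller ones through a wire `w`. -/
theorem flip_union {t w : Fin n} {A B : Finset (Fin n)} (hAB : Disjoint A B)
    (htA : t ∉ A) (htB : t ∉ B) (hwA : w ∉ A) (hwB : w ∉ B) (hwt : w ≠ t) (x : BVec n) :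
    flip t (insert w B) (flip w A (flip t (insert w B) (flip w A x))) = flip t (A ∪ B) x := by
  have h1 : t ∉ insert w B := by simp [htB, hwt.symm]
  ext i
  by_cases hi : i = t
  · subst hi
    rw [flip_target, flip_of_ne _ _ hwt.symm, flip_target, flip_of_ne _ _ hwt.symm, flip_target,
      Finset.prod_union hAB, Finset.prod_insert hwB, Finset.prod_insert hwB]
    simp only [prod_flip hwB, prod_flip htB, flip_target, prod_flip htA, prod_flip hwA,
      flip_of_ne _ _ hwt]
    have h2 : (2 : ZMod 2) = 0 := rfl
    linear_combination (x w * ∏ i ∈ B, x i + (∏ i ∈ A, x i) * ∏ i ∈ B, x i) * h2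
  · rw [flip_of_ne _ _ hi, flip_of_ne _ _ hi]
    by_cases hw : i = w
    · subst hw
      rw [flip_target, flip_of_ne _ _ hi, prod_flip htA, flip_target, prod_flip hwA, add_assoc,
        CharTwo.add_self_eq_zero, add_zero]
    · rw [flip_of_ne _ _ hw, flip_of_ne _ _ hi, flip_of_ne _ _ hw]

/-- `flip` as a permutation. -/
def flipPerm (t : Fin n) (I : Finset (Fin n)) (h : t ∉ I) : Equiv.Perm (BVec n) where
  toFun := flip t I
  invFun := flip t I
  left_inv := flip_flip h
  right_inv := flip_flip h

/-- An unused wire `w` makes the flip a commutator of two involutions, that is, the square of their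
product; squares are even. -/
theorem sign_flipPerm {t w : Fin n} {I : Finset (Fin n)} (h : t ∉ I) (hw : w ∉ insert t I) :
    Equiv.Perm.sign (flipPerm t I h) = 1 := by
  simp only [Finset.mem_insert, not_or] at hw
  have hB : t ∉ insert w (∅ : Finset (Fin n)) := by simpa using Ne.symm hw.1
  have : flipPerm t I h =
      flipPerm t (insert w ∅) hB * flipPerm w I hw.2 *
        (flipPerm t (insert w ∅) hB * flipPerm w I hw.2) := by
    ext x i
    have := flip_union (Finset.disjoint_empty_right I) h (Finset.notMem_empty t) hw.2
      (Finset.notMem_empty w) hw.1 x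
    rw [Finset.union_empty] at this
    exact (congrFun this i).symm
  rw [this, Equiv.Perm.sign_mul]
  exact Int.units_mul_self _

theorem Circuit.sign_perm (hn : 4 ≤ n) (c : Circuit n) : Equiv.Perm.sign c.perm = 1 := by
  induction c with
  | nil => exact Equiv.Perm.sign_one
  | cons g c ih =>
    have hg : (Circuit.perm (g :: c)) =
        Circuit.perm c * flipPerm g.target g.controls g.target_notMem := by
      ext x i; rfl
    obtain ⟨w, hw⟩ : ∃ w, w ∉ insert g.target g.controls := by
      by_contra! h
      have h1 : insert g.target g.controls = Finset.univ := Finset.eq_univ_iff_forall.2 h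
      have h2 := congrArg Finset.card h1
      rw [Finset.card_insert_of_notMem g.target_notMem, Finset.card_univ, Fintype.card_fin] at h2
      have := g.card_le_two
      omega
    rw [hg, Equiv.Perm.sign_mul, ih, sign_flipPerm _ hw, one_mul]

/-! ### Multiply controlled flips -/

/-- Some circuit with at most `k` gates defines `F`. -/
def Computes (F : BVec n → BVec n) (k : ℕ) : Prop :=
  ∃ c : Circuit n, c.length ≤ k ∧ ∀ x, c.eval x = F x

theorem Computes.mono {F : BVec n → BVec n} {k l : ℕ} (h : Computes F k) (hkl : k ≤ l) :
    Computes F l := by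
  obtain ⟨c, hc, h⟩ := h
  exact ⟨c, hc.trans hkl, h⟩

theorem Computes.congr {F G : BVec n → BVec n} {k : ℕ} (h : Computes F k) (hFG : ∀ x, F x = G x) :
    Computes G k := by
  rwa [← funext hFG]

theorem Computes.comp {F G : BVec n → BVec n} {k l : ℕ} (hG : Computes G l) (hF : Computes F k) :
    Computes (fun x => G (F x)) (k + l) := by
  obtain ⟨c, hc, hF⟩ := hF
  obtain ⟨d, hd, hG⟩ := hG
  refine ⟨c ++ d, by rw [List.length_append]; omega, fun x => ?_⟩
  rw [Circuit.eval_append, hF, hG]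

theorem Computes.id (n : ℕ) : Computes (fun x : BVec n => x) 0 := ⟨[], le_rfl, fun _ => rfl⟩

theorem computes_flip_of_card_le_two {t : Fin n} {I : Finset (Fin n)} (h : t ∉ I)
    (hI : I.card ≤ 2) : Computes (flip t I) 1 :=
  ⟨[⟨t, I, h, hI⟩], le_rfl, fun _ => rfl⟩

/-- Adds to the second wire of each pair the product of the first wires of this and all later
pairs. -/
def ladder : List (Fin n × Fin n) → BVec n → BVec n
  | [], x => x
  | (c, a) :: L, x =>
    Function.update (ladder L x) a (x a + x c * (L.map fun e => x e.1).prod)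

theorem ladder_of_notMem {L : List (Fin n × Fin n)} {i : Fin n} (h : ∀ e ∈ L, i ≠ e.2)
    (x : BVec n) : ladder L x i = x i := by
  induction L with
  | nil => rfl
  | cons e L ih =>
    rw [ladder, Function.update_of_ne (h e (by simp)), ih fun e he => h e (by simp [he])]

theorem ladder_update {L : List (Fin n × Fin n)} {a : Fin n} (h : ∀ e ∈ L, a ≠ e.1 ∧ a ≠ e.2)
    (x : BVec n) (v : ZMod 2) :
    ladder L (Function.update x a v) = Function.update (ladder L x) a v := by
  induction L with
  | nil => rfl
  | cons e L ih =>
    have h1 : (L.map fun e => Function.update x a v e.1) = L.map fun e => x e.1 :=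
      List.map_congr_left fun e he => Function.update_of_ne (h e (by simp [he])).1.symm _ _
    have h2 := h e (by simp)
    rw [ladder, ladder, ih fun e he => h e (by simp [he]), h1, Function.update_of_ne h2.2.symm,
      Function.update_of_ne h2.1.symm, Function.update_comm h2.2]

/-- All wires occurring in the list of pairs are distinct. -/
def Separated : List (Fin n × Fin n) → Prop
  | [] => True
  | e :: L => e.1 ≠ e.2 ∧ (∀ f ∈ L, e.1 ≠ f.2 ∧ e.2 ≠ f.1 ∧ e.2 ≠ f.2 ∧ e.1 ≠ f.1) ∧ Separated L

theorem ladder_map_fst {L M : List (Fin n × Fin n)} (h : ∀ e ∈ L, ∀ f ∈ M, e.1 ≠ f.2)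
    (x : BVec n) : (L.map fun e => ladder M x e.1) = L.map fun e => x e.1 :=
  List.map_congr_left fun e he => ladder_of_notMem (h e he) x

theorem Separated.fst_ne_snd {L : List (Fin n × Fin n)} (h : Separated L) :
    ∀ e ∈ L, ∀ f ∈ L, e.1 ≠ f.2 := by
  induction L with
  | nil => simp
  | cons e L ih =>
    obtain ⟨h1, h2, h3⟩ := h
    intro f hf g hg
    rcases List.mem_cons.1 hf with rfl | hf' <;> rcases List.mem_cons.1 hg with rfl | hg'
    · exact h1
    · exact (h2 g hg').1
    · exact (h2 f hf').2.1.symm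
    · exact ih h3 f hf' g hg'

theorem ladder_ladder {L : List (Fin n × Fin n)} (h : Separated L) (x : BVec n) :
    ladder L (ladder L x) = x := by
  induction L with
  | nil => rfl
  | cons e L ih =>
    have h0 := h.fst_ne_snd
    obtain ⟨h1, h2, h3⟩ := h
    have h4 : ladder L (ladder (e :: L) x) =
        Function.update x e.2 (x e.2 + x e.1 * (L.map fun e => x e.1).prod) := by
      rw [ladder, ladder_update fun f hf => ⟨(h2 f hf).2.1, (h2 f hf).2.2.1⟩, ih h3]
    rw [ladder, h4, ladder_map_fst fun f hf g hg => h0 f (by simp [hf]) g hg,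
      ladder_of_notMem fun f hf => h0 e (by simp) f (by simp [hf])]
    rw [ladder, Function.update_self, add_assoc, CharTwo.add_self_eq_zero, add_zero,
      Function.update_idem, Function.update_eq_self]

/-- Each further pair costs two gates: before and after the shorter ladder, add `x c` times the next
target wire. The old contents of that wire cancel, leaving `x c` times the product that the shorter
ladder wrote there. -/
theorem computes_ladder {L : List (Fin n × Fin n)} (h : Separated L) :
    Computes (ladder L) (2 * L.length) := by
  induction L with
  | nil => exact Computes.id n
  | cons e L ih =>
    cases L with
    | nil =>
      refine (computes_flip_of_card_le_two (t := e.2) (I := {e.1})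
        (by simpa using h.1.symm) (by simp)).mono (by simp) |>.congr fun x => ?_
      simp [flip, ladder]
    | cons f M =>
      obtain ⟨h1, h2, h3⟩ := h
      have hf := h2 f (by simp)
      have hef : e.2 ∉ ({e.1, f.2} : Finset (Fin n)) := by simp [h1.symm, hf.2.2.1]
      have hT := computes_flip_of_card_le_two hef Finset.card_le_two
      refine ((hT.comp ((ih h3).comp hT)).mono (by simp only [List.length_cons]; omega)).congr
        fun x => ?_
      have hpr : ∀ y : BVec n, ∏ i ∈ ({e.1, f.2} : Finset (Fin n)), y i = y e.1 * y f.2 :=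
        fun y => Finset.prod_pair hf.1
      have hl : ladder (f :: M) x f.2 = x f.2 + x f.1 * (M.map fun e => x e.1).prod := by
        rw [ladder, Function.update_self]
      rw [flip, flip, hpr, hpr, ladder_update fun g hg => ⟨(h2 g hg).2.1, (h2 g hg).2.2.1⟩,
        show ladder (e :: f :: M) x = Function.update (ladder (f :: M) x) e.2
          (x e.2 + x e.1 * ((f :: M).map fun e => x e.1).prod) from rfl]
      simp only [Function.update_self, Function.update_idem]
      rw [Function.update_of_ne h1, Function.update_of_ne hf.2.2.1.symm, hl,
        ladder_of_notMem fun g hg => (h2 g hg).1]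
      congr 1
      have h2 : (2 : ZMod 2) = 0 := rfl
      simp only [List.map_cons, List.prod_cons]
      linear_combination (x e.1 * x f.2) * h2

theorem separated_zip {l l' : List (Fin n)} (hl : l.Nodup) (hl' : l'.Nodup) (h : l.Disjoint l') :
    Separated (l.zip l') := by
  induction l generalizing l' with
  | nil => trivial
  | cons a l ih =>
    cases l' with
    | nil => trivial
    | cons b l' =>
      rw [List.nodup_cons] at hl hl'
      simp only [List.disjoint_cons_left, List.disjoint_cons_right, List.mem_cons, not_or] at h
      refine ⟨Ne.symm h.1.1, fun f hf => ?_, ih hl.2 hl'.2 h.2.2⟩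
      obtain ⟨h1, h2⟩ := List.of_mem_zip (show (f.1, f.2) ∈ l.zip l' from hf)
      exact ⟨ne_of_mem_of_not_mem h2 h.2.1 |>.symm, ne_of_mem_of_not_mem h1 h.1.2 |>.symm,
        ne_of_mem_of_not_mem h2 hl'.1 |>.symm, ne_of_mem_of_not_mem h1 hl.1 |>.symm⟩

/-- A multiply controlled flip is cheap when there are almost as many unused wires as controls. -/
theorem computes_flip_of_unused {t : Fin n} {I J : Finset (Fin n)} (ht : t ∉ I) (htJ : t ∉ J)
    (hIJ : Disjoint I J) (hc : I.card ≤ J.card + 1) : Computes (flip t I) (4 * I.card + 1) := by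
  rcases I.eq_empty_or_nonempty with rfl | hne
  · exact computes_flip_of_card_le_two ht (by simp)
  obtain ⟨a, I', ha, rfl⟩ : ∃ a I', a ∉ I' ∧ I = insert a I' := by
    obtain ⟨a, ha⟩ := hne
    exact ⟨a, I.erase a, by simp, (Finset.insert_erase ha).symm⟩
  rw [Finset.card_insert_of_notMem ha] at hc ⊢
  obtain ⟨J', hJ', hJc⟩ := Finset.exists_subset_card_eq (show I'.card ≤ J.card by omega)
  simp only [Finset.mem_insert, not_or] at ht
  rw [Finset.disjoint_insert_left] at hIJ
  have hd : (a :: I'.toList).Disjoint (t :: J'.toList) := by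
    simp only [List.disjoint_cons_left, List.disjoint_cons_right, List.mem_cons, not_or,
      Finset.mem_toList]
    refine ⟨⟨ht.1, ht.2⟩, fun h => hIJ.1 (hJ' h), fun i hi hj => ?_⟩
    exact Finset.disjoint_left.1 hIJ.2 (Finset.mem_toList.1 hi) (hJ' (Finset.mem_toList.1 hj))
  have hS : Separated ((a, t) :: I'.toList.zip J'.toList) :=
    separated_zip (l := a :: I'.toList) (l' := t :: J'.toList)
      (List.nodup_cons.2 ⟨by simpa using ha, I'.nodup_toList⟩)
      (List.nodup_cons.2 ⟨by simpa using fun h => htJ (hJ' h), J'.nodup_toList⟩) hd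
  have hlen : (I'.toList.zip J'.toList).length = I'.card := by simp [hJc]
  -- The full ladder also disturbs the borrowed wires `J'`. Running its tail again restores them,
  -- whatever they carried, and leaves only the change of `t`.
  refine (((computes_ladder hS.2.2).comp (computes_ladder hS)).mono
    (by rw [List.length_cons, hlen]; omega)).congr fun x => ?_
  rw [show ladder ((a, t) :: I'.toList.zip J'.toList) x = Function.update _ _ _ from rfl,
    ladder_update fun f hf => ⟨(hS.2.1 f hf).2.1, (hS.2.1 f hf).2.2.1⟩,
    ladder_ladder hS.2.2, flip, Finset.prod_insert ha]
  have hm : (I'.toList.zip J'.toList).map (fun e => x e.1) = I'.toList.map x := by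
    rw [show (fun e : Fin n × Fin n => x e.1) = x ∘ Prod.fst from rfl, ← List.map_map,
      List.map_fst_zip (by simp [hJc])]
  rw [hm, Finset.prod_map_toList]

/-- A multiply controlled flip with one unused wire. -/
theorem computes_flip {t w : Fin n} {I : Finset (Fin n)} (ht : t ∉ I) (hw : w ∉ insert t I) :
    Computes (flip t I) (8 * I.card + 12) := by
  -- Halving the controls lets each half serve as the borrowed wires for the flips controlled by the
  -- other half.
  obtain ⟨A, hA, hAc⟩ := Finset.exists_subset_card_eq (show (I.card + 1) / 2 ≤ I.card by omega)
  have hB := Finset.card_sdiff_of_subset hA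
  set B := I \ A
  have hAB : Disjoint A B := Finset.disjoint_sdiff
  have hI : A ∪ B = I := Finset.union_sdiff_of_subset hA
  simp only [Finset.mem_insert, not_or] at hw
  have hsub : B ⊆ I := Finset.sdiff_subset
  have htA : t ∉ A := fun h => ht (hA h)
  have htB : t ∉ B := fun h => ht (hsub h)
  have hwA : w ∉ A := fun h => hw.2 (hA h)
  have hwB : w ∉ B := fun h => hw.2 (hsub h)
  have htwB : t ∉ insert w B := by simp [htB, Ne.symm hw.1]
  have h1 := computes_flip_of_unused hwA hwB hAB (by omega)
  have h2 := computes_flip_of_unused htwB htA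
    (Finset.disjoint_insert_left.2 ⟨hwA, hAB.symm⟩)
    (by rw [Finset.card_insert_of_notMem hwB]; omega)
  rw [Finset.card_insert_of_notMem hwB] at h2
  refine ((h2.comp (h1.comp (h2.comp h1))).mono (by omega)).congr fun x => ?_
  rw [flip_union hAB htA htB hwA hwB hw.1, hI]

/-- Negates the wires of `U`. -/
def negate (U : Finset (Fin n)) (x : BVec n) : BVec n := fun i => if i ∈ U then x i + 1 else x i

theorem negate_negate (U : Finset (Fin n)) (x : BVec n) : negate U (negate U x) = x := by
  ext i
  by_cases h : i ∈ U <;> simp [negate, h, add_assoc, CharTwo.add_self_eq_zero]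

theorem computes_negate (U : Finset (Fin n)) : Computes (negate U) U.card := by
  induction U using Finset.induction_on with
  | empty => exact (Computes.id n).congr fun x => by ext i; simp [negate]
  | insert a U ha ih =>
    rw [Finset.card_insert_of_notMem ha]
    refine (((computes_flip_of_card_le_two (Finset.notMem_empty a) (by simp)).comp ih)).congr
      fun x => ?_
    ext i
    by_cases hi : i = a
    · subst hi
      simp [flip, negate, ha]
    · simp [flip, negate, hi]

/-- Adding the wire `r j` to the wire `j` for all `j ∈ V` takes one gate per wire. -/
theorem computes_addWires {r : Fin n → Fin n} {V : Finset (Fin n)} (h : ∀ j, r j ∉ V) :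
    Computes (fun x j => if j ∈ V then x j + x (r j) else x j) V.card := by
  induction V using Finset.induction_on with
  | empty => exact (Computes.id n).congr fun x => by ext i; simp
  | insert a U ha ih =>
    rw [Finset.card_insert_of_notMem ha]
    have hr : ∀ j, r j ≠ a ∧ r j ∉ U := fun j => by simpa [not_or] using h j
    refine ((computes_flip_of_card_le_two (t := a) (I := {r a}) (by simpa using (hr a).1.symm)
      (by simp)).comp (ih fun j => (hr j).2)).congr fun x => ?_
    ext i
    by_cases hi : i = a
    · subst hi
      simp [flip, ha, (hr i).2]
    · simp [flip, hi]

/-- Flipping the wire `w` when the wires of `C` carry the values of `z`. -/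
theorem computes_flipAt {C : Finset (Fin n)} {w v : Fin n} (hw : w ∉ C) (hv : v ∉ insert w C)
    (z : BVec n) :
    Computes (fun x => Function.update x w (x w + if ∀ i ∈ C, x i = z i then 1 else 0))
      (10 * C.card + 12) := by
  set U := C.filter fun i => z i = 0
  have hU : U.card ≤ C.card := Finset.card_filter_le _ _
  have hwU : w ∉ U := fun h => hw (Finset.filter_subset _ _ h)
  refine (((computes_negate U).comp ((computes_flip hw hv).comp (computes_negate U))).mono
    (by omega)).congr fun x => ?_
  have hp : ∏ i ∈ C, negate U x i = if ∀ i ∈ C, x i = z i then 1 else 0 := by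
    have h01 : ∀ a : ZMod 2, a = 0 ∨ a = 1 := by decide
    split_ifs with h
    · refine Finset.prod_eq_one fun i hi => ?_
      rcases h01 (z i) with h0 | h0 <;> simp [negate, U, hi, h0, h i hi]
    · push Not at h
      obtain ⟨i, hi, hne⟩ := h
      refine Finset.prod_eq_zero hi ?_
      rcases h01 (z i) with h0 | h0 <;> rcases h01 (x i) with h1 | h1 <;>
        simp [h0, h1] at hne <;> simp [negate, U, hi, h0, h1, CharTwo.add_self_eq_zero]
  rw [flip, hp]
  ext i
  by_cases hi : i = w
  · subst hi
    simp [negate, hwU]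
  · have := congrFun (negate_negate U x) i
    simp only [negate, Function.update_of_ne hi] at this ⊢
    exact this

/-! ### Moving families of points -/

/-- Some circuit with at most `k` gates maps each point `p s` to `q s`. -/
def Moves {S : Type*} (p q : S → BVec n) (k : ℕ) : Prop :=
  ∃ c : Circuit n, c.length ≤ k ∧ ∀ s, c.eval (p s) = q s

section Moves

variable {S : Type*} {p q r : S → BVec n}

theorem Moves.trans {k l : ℕ} (h : Moves p q k) (h' : Moves q r l) : Moves p r (k + l) := by
  obtain ⟨c, hc, h⟩ := h
  obtain ⟨d, hd, h'⟩ := h'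
  refine ⟨c ++ d, by rw [List.length_append]; omega, fun s => ?_⟩
  rw [Circuit.eval_append, h, h']

theorem Moves.mono {k l : ℕ} (h : Moves p q k) (hkl : k ≤ l) : Moves p q l := by
  obtain ⟨c, hc, h⟩ := h
  exact ⟨c, hc.trans hkl, h⟩

theorem Moves.refl (p : S → BVec n) : Moves p p 0 := ⟨[], le_rfl, fun _ => rfl⟩

theorem Computes.moves {F : BVec n → BVec n} {k : ℕ} (h : Computes F k) (p : S → BVec n) :
    Moves p (fun s => F (p s)) k := by
  obtain ⟨c, hc, h⟩ := h
  exact ⟨c, hc, fun s => h _⟩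

/-- The wires of `C` tell the points of the family apart. -/
def Separates (C : Finset (Fin n)) (p : S → BVec n) : Prop :=
  ∀ s s', (∀ i ∈ C, p s i = p s' i) → s = s'

/-- An arbitrary function of the index can be added to a wire. -/
theorem moves_addFun [Fintype S] [DecidableEq S] {C : Finset (Fin n)} {w v : Fin n}
    (hp : Separates C p) (hw : w ∉ C) (hv : v ∉ insert w C) (F : S → ZMod 2) :
    Moves p (fun s => Function.update (p s) w (p s w + F s))
      (Fintype.card S * (10 * C.card + 12)) := by
  suffices H : ∀ U : Finset S, Moves p
      (fun s => Function.update (p s) w (p s w + if s ∈ U then F s else 0))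
      (U.card * (10 * C.card + 12)) by
    simpa using H Finset.univ
  intro U
  induction U using Finset.induction_on with
  | empty => simpa using Moves.refl p
  | insert a U ha ih =>
    rw [Finset.card_insert_of_notMem ha, add_mul, one_mul]
    have h01 : F a = 0 ∨ F a = 1 := by
      generalize F a = b; revert b; decide
    rcases h01 with h0 | h1
    · convert ih.mono (Nat.le_add_right _ (10 * C.card + 12)) using 1
      ext s : 1
      congr 2
      by_cases hs : s = a
      · subst hs; simp [ha, h0]
      · simp [hs]
    · convert ih.trans ((computes_flipAt hw hv (p a)).moves _) using 1
      ext s : 1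
      -- Earlier additions touched only `w ∉ C`, so the pattern of `p a` on `C` still singles out
      -- the index `a`.
      have hC : ∀ i ∈ C, i ≠ w := fun i hi h => hw (h ▸ hi)
      have hiff : (∀ i ∈ C, Function.update (p s) w (p s w + if s ∈ U then F s else 0) i = p a i) ↔
          s = a := by
        constructor
        · intro h
          exact hp _ _ fun i hi => by rw [← h i hi, Function.update_of_ne (hC i hi)]
        · rintro rfl i hi
          rw [Function.update_of_ne (hC i hi)]
      simp only [hiff, Function.update_self, Function.update_idem]
      congr 1
      by_cases hs : s = a
      · subst hs; simp [ha, h1]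
      · simp [hs]

/-- The wires of `W` can be rewritten arbitrarily as long as other wires tell the points apart. -/
theorem moves_rewrite [Fintype S] [DecidableEq S] {C W : Finset (Fin n)} (hC : C.card + 2 ≤ n)
    (hp : Separates C p) (hCW : Disjoint C W) (hpq : ∀ s, ∀ i ∉ W, q s i = p s i) :
    Moves p q (W.card * (Fintype.card S * (10 * C.card + 12))) := by
  induction W using Finset.induction_on generalizing q with
  | empty =>
    have : q = p := by ext s i; exact hpq s i (by simp)
    subst this
    simpa using Moves.refl q
  | insert w W hw ih =>
    rw [Finset.disjoint_insert_right] at hCW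
    rw [Finset.card_insert_of_notMem hw, add_mul, one_mul]
    obtain ⟨v, hv⟩ : ∃ v, v ∉ insert w C := by
      by_contra! h
      have h2 := congrArg Finset.card (Finset.eq_univ_iff_forall.2 h)
      rw [Finset.card_insert_of_notMem hCW.1, Finset.card_univ, Fintype.card_fin] at h2
      omega
    have h1 : Moves p (fun s => Function.update (q s) w (p s w)) _ :=
      ih hCW.2 fun s i hi => by
        by_cases hiw : i = w
        · subst hiw; simp
        · rw [Function.update_of_ne hiw]
          exact hpq s i (by simp [hiw, hi])
    have hS : Separates C (fun s => Function.update (q s) w (p s w)) := by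
      intro s s' h
      refine hp s s' fun i hi => ?_
      have hiw : i ≠ w := fun e => hCW.1 (e ▸ hi)
      have hiW : i ∉ insert w W := by
        simp [hiw, Finset.disjoint_left.1 hCW.2 hi]
      have := h i hi
      simp only [Function.update_of_ne hiw] at this
      rw [← hpq s i hiW, ← hpq s' i hiW, this]
    convert h1.trans (moves_addFun hS hCW.1 hv fun s => p s w + q s w) using 1
    ext s : 1
    simp [← add_assoc, CharTwo.add_self_eq_zero]

/-- All wires outside a small set can be set to `1` on the points of a family. -/
theorem moves_compress [Fintype S] (p : S → BVec n) (hp : Function.Injective p) :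
    ∃ (R : Finset (Fin n)) (q : S → BVec n), R.card ≤ 2 ^ Fintype.card S ∧
      Moves p q (n + 2 ^ Fintype.card S) ∧ Separates R q ∧ ∀ s, ∀ i ∉ R, q s i = 1 := by
  classical
  rcases Nat.eq_zero_or_pos n with rfl | hn
  · exact ⟨∅, p, by simp, (Moves.refl p).mono (Nat.zero_le _),
      fun s s' _ => hp (Subsingleton.elim _ _), fun s i => i.elim0⟩
  have : Nonempty (Fin n) := ⟨⟨0, hn⟩⟩
  let col : Fin n → S → ZMod 2 := fun i s => p s i
  -- `ρ` picks one representative wire for each class of wires with equal columns.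
  let ρ : Fin n → Fin n := fun j => Function.invFun col (col j)
  have hρ : ∀ j, col (ρ j) = col j := fun j => Function.invFun_eq ⟨j, rfl⟩
  have hρρ : ∀ j, ρ (ρ j) = ρ j := fun j => by
    change Function.invFun col (col (ρ j)) = _
    rw [hρ]
  let R : Finset (Fin n) := Finset.univ.image ρ
  have hR : R.card ≤ 2 ^ Fintype.card S := by
    have h1 : R ⊆ (Finset.univ : Finset (S → ZMod 2)).image (Function.invFun col) := by
      intro i hi
      obtain ⟨j, -, rfl⟩ := Finset.mem_image.1 hi
      exact Finset.mem_image_of_mem _ (Finset.mem_univ _)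
    refine (Finset.card_le_card h1).trans (Finset.card_image_le.trans ?_)
    simp [ZMod.card]
  have hρR : ∀ j, ρ j ∈ R := fun j => Finset.mem_image_of_mem _ (Finset.mem_univ _)
  -- After negating the representatives, a wire `j ∉ R` and its representative carry complementary
  -- values, so adding the latter to the former gives `1` at every point.
  have h1 := (computes_negate R).moves p
  have h2 := (computes_addWires (r := ρ) (V := Rᶜ) fun j => by simpa using hρR j).moves
    (fun s => negate R (p s))
  have hc : Rᶜ.card ≤ n := (Finset.card_le_univ _).trans (by simp)
  refine ⟨R, _, hR, (h1.trans h2).mono (by omega), ?_, ?_⟩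
  · intro s s' h
    refine hp ?_
    ext i
    have h3 := h (ρ i) (hρR i)
    simp only [Finset.mem_compl, hρR, not_true_eq_false, if_false, negate, if_true,
      add_left_inj] at h3
    have h4 := congrFun (hρ i) s
    have h5 := congrFun (hρ i) s'
    simp only [col] at h4 h5
    rw [← h4, ← h5, h3]
  · intro s i hi
    have h4 : p s (ρ i) = p s i := congrFun (hρ i) s
    simp only [Finset.mem_compl, hi, not_false_eq_true, if_true, negate, hρR, if_false, h4]
    rw [← add_assoc, CharTwo.add_self_eq_zero, zero_add]

/-- Points indexed by `BVec k` can be moved to a standard subcube. -/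
theorem moves_subcube {k : ℕ} (hk : 2 ≤ k) (hn : 2 ^ 2 ^ k + k ≤ n) (p : BVec k → BVec n)
    (hp : Function.Injective p) : ∃ e : Fin k ↪ Fin n,
      Moves p (fun s i => if h : ∃ j, e j = i then s h.choose else 1)
        (n + 45 * (2 ^ k) ^ 2 * 2 ^ 2 ^ k) := by
  classical
  obtain ⟨R, q, hR, hpq, hq, hq1⟩ := moves_compress p hp
  have hS : Fintype.card (BVec k) = 2 ^ k := by simp [ZMod.card]
  rw [hS] at hR hpq
  have hkk : k < 2 ^ k := Nat.lt_two_pow_self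
  have hkD : 2 ^ k < 2 ^ 2 ^ k := Nat.lt_two_pow_self
  have hRc : Rᶜ.card = n - R.card := by rw [Finset.card_compl, Fintype.card_fin]
  obtain ⟨E, hER, hEc⟩ := Finset.exists_subset_card_eq (show k ≤ Rᶜ.card by omega)
  have hRE : Disjoint R E := Finset.disjoint_left.2 fun i hi hE => by simpa [hi] using hER hE
  let e : Fin k ↪ Fin n := (E.orderEmbOfFin hEc).toEmbedding
  have heE : ∀ i, i ∈ E ↔ ∃ j, e j = i := fun i => by
    rw [← Finset.mem_coe, ← Finset.range_orderEmbOfFin E hEc]; rfl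
  let code : BVec k → BVec n := fun s i => if h : ∃ j, e j = i then s h.choose else 1
  have hcode : ∀ s j, code s (e j) = s j := fun s j => by
    have h : ∃ j', e j' = e j := ⟨j, rfl⟩
    simp only [code, dif_pos h]
    rw [e.injective h.choose_spec]
  have hcode1 : ∀ s, ∀ i ∉ E, code s i = 1 := fun s i hi => dif_neg fun h => hi ((heE i).2 h)
  -- The index is written on `E` while `R` still tells the points apart; afterwards `E` does so, and
  -- `R` can be overwritten by `1`.
  let q' : BVec k → BVec n := fun s i => if i ∈ E then code s i else q s i
  have h2 : Moves q q' _ := moves_rewrite (C := R) (W := E) (by omega) hq hRE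
    fun s i hi => if_neg hi
  have hE : Separates E q' := fun s s' h => by
    ext j
    have hj := (heE (e j)).2 ⟨j, rfl⟩
    have := h (e j) hj
    simpa [q', hj, hcode] using this
  have h3 : Moves q' code _ := moves_rewrite (C := E) (W := R) (by omega) hE hRE.symm
    fun s i hi => by
      by_cases hiE : i ∈ E
      · simp [q', hiE]
      · simp [q', hiE, hcode1, hq1 s i hi]
  refine ⟨e, (hpq.trans (h2.trans h3)).mono ?_⟩
  rw [hS, hEc]
  have hs : 4 ≤ 2 ^ k := Nat.pow_le_pow_right (n := 2) (by norm_num) hk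
  generalize 2 ^ 2 ^ k = D at *
  generalize 2 ^ k = s at *
  have a1 : k * (s * (10 * R.card + 12)) ≤ s * (s * (10 * D + 12)) := by gcongr
  have a2 : R.card * (s * (10 * k + 12)) ≤ D * (s * (10 * s + 12)) := by gcongr
  have a3 : s * s * 12 ≤ s * s * D * 6 := by nlinarith
  have a4 : D * s * 12 ≤ D * (s * s) * 6 := by
    have : s * 2 ≤ s * s := by gcongr; omega
    nlinarith
  have a5 : D ≤ D * (s * s) := Nat.le_mul_of_pos_right _ (by positivity)
  nlinarith

end Moves

/-! ### Groups of disjoint transpositions -/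

/-- The number of gates spent on `2 ^ m` disjoint transpositions. -/
def groupCost (n m : ℕ) : ℕ := 10 * n + 12 + 90 * (2 ^ (m + 1)) ^ 2 * 2 ^ 2 ^ (m + 1)

/-- Adding `1` to the first index coordinate of a family of points takes few gates. -/
theorem exists_circuit_pairing {m : ℕ} (hm : 1 ≤ m) (hn : 2 ^ 2 ^ (m + 1) + (m + 1) ≤ n)
    (p : BVec (m + 1) → BVec n) (hp : Function.Injective p) :
    ∃ c : Circuit n, c.length ≤ groupCost n m ∧
      (∀ s, c.eval (p s) = p (Function.update s 0 (s 0 + 1))) ∧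
      ∀ x, (∀ s, x ≠ p s) → c.eval x = x := by
  classical
  obtain ⟨e, P, hPl, hP⟩ := moves_subcube (by omega) hn p hp
  set code : BVec (m + 1) → BVec n := fun s i => if h : ∃ j, e j = i then s h.choose else 1
  have hcode : ∀ s j, code s (e j) = s j := fun s j => by
    have h : ∃ j', e j' = e j := ⟨j, rfl⟩
    simp only [code, dif_pos h]
    rw [e.injective h.choose_spec]
  -- The standard subcube is exactly where all wires of `C` carry `1`, so the flip of `e 0`
  -- controlled by `C` acts there and nowhere else.
  let C : Finset (Fin n) := (Finset.univ.map e)ᶜ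
  have hC : ∀ i, i ∈ C ↔ ¬ ∃ j, e j = i := fun i => by simp [C]
  have hC1 : ∀ s, ∀ i ∈ C, code s i = 1 := fun s i hi => dif_neg ((hC i).1 hi)
  have heC : ∀ j, e j ∉ C := fun j h => (hC _).1 h ⟨j, rfl⟩
  -- The spare wire for `computes_flip` is the last index wire, distinct from `e 0` because `1 ≤ m`.
  have hw : e (Fin.last m) ∉ insert (e 0) C := by
    rw [Finset.mem_insert, not_or]
    refine ⟨fun h => ?_, heC _⟩
    have := congrArg Fin.val (e.injective h)
    simp at this
    omega
  obtain ⟨M, hMl, hM⟩ := computes_flip (heC 0) hw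
  have hflip : ∀ s, flip (e 0) C (code s) = code (Function.update s 0 (s 0 + 1)) := fun s => by
    ext i
    by_cases hi : ∃ j, e j = i
    · obtain ⟨j, rfl⟩ := hi
      rw [hcode]
      by_cases hj : j = 0
      · subst hj
        rw [flip_target, Finset.prod_eq_one (hC1 s), hcode, Function.update_self]
      · rw [flip_of_ne _ _ fun h => hj (e.injective h), hcode, Function.update_of_ne hj]
    · rw [flip_of_ne _ _ fun h => hi ⟨0, h.symm⟩, hC1 _ i ((hC i).2 hi), hC1 _ i ((hC i).2 hi)]
  have hfix : ∀ y, (∀ s, y ≠ code s) → flip (e 0) C y = y := fun y hy => by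
    obtain ⟨i, hi, hne⟩ : ∃ i ∈ C, y i ≠ 1 := by
      by_contra! h
      let s : BVec (m + 1) := fun j => y (e j)
      refine hy s (funext fun i => ?_)
      by_cases hi : ∃ j, e j = i
      · obtain ⟨j, rfl⟩ := hi
        exact (hcode s j).symm
      · exact (h i ((hC i).2 hi)).trans (hC1 s i ((hC i).2 hi)).symm
    have h0 : y i = 0 := by
      revert hne; generalize y i = a; revert a; decide
    rw [flip, Finset.prod_eq_zero hi h0, add_zero, Function.update_eq_self]
  have heval : ∀ x, Circuit.eval (P ++ M ++ P.reverse) x =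
      Circuit.eval P.reverse (flip (e 0) C (Circuit.eval P x)) := fun x => by
    rw [Circuit.eval_append, Circuit.eval_append, hM]
  have hCc : C.card ≤ n := (Finset.card_le_univ _).trans (by simp)
  refine ⟨P ++ M ++ P.reverse, ?_, fun s => ?_, fun x hx => ?_⟩
  · simp only [List.length_append, List.length_reverse, groupCost]
    nlinarith
  · rw [heval, hP, hflip, ← hP, Circuit.eval_reverse_eval]
  · rw [heval, hfix, Circuit.eval_reverse_eval]
    intro s h
    refine hx s ?_
    rw [← Circuit.eval_reverse_eval P x, h, ← hP, Circuit.eval_reverse_eval]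

/-- Disjoint transpositions `(a, τ a)` for `a ∈ A`. -/
theorem exists_circuit_swaps {m : ℕ} (hm : 1 ≤ m) (hn : 2 ^ 2 ^ (m + 1) + (m + 1) ≤ n)
    (A : Finset (BVec n)) (τ : Equiv.Perm (BVec n)) (hA : A.card = 2 ^ m)
    (hd : ∀ a ∈ A, τ a ∉ A) :
    ∃ c : Circuit n, c.length ≤ groupCost n m ∧ (∀ a ∈ A, c.eval a = τ a ∧ c.eval (τ a) = a) ∧
      ∀ x, x ∉ A → τ.symm x ∉ A → c.eval x = x := by
  classical
  have hcard : Fintype.card (BVec m) = Fintype.card A := by simp [ZMod.card, hA]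
  let E : BVec m ≃ A := Fintype.equivOfCardEq hcard
  -- Index coordinate `0` selects between `a` and `τ a`, so adding `1` to it performs all the swaps.
  let p : BVec (m + 1) → BVec n := fun s =>
    if s 0 = 0 then E (Fin.tail s) else τ (E (Fin.tail s))
  have h01 : ∀ a : ZMod 2, a ≠ 0 → a = 1 := by decide
  have hp : Function.Injective p := by
    intro s s' h
    suffices h : s 0 = s' 0 ∧ Fin.tail s = Fin.tail s' by
      rw [← Fin.cons_self_tail s, ← Fin.cons_self_tail s', h.1, h.2]
    by_cases h0 : s 0 = 0 <;> by_cases h0' : s' 0 = 0 <;> simp only [p, h0, h0', if_true, if_false]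
      at h
    · exact ⟨h0.trans h0'.symm, E.injective (Subtype.ext h)⟩
    · exact absurd (h ▸ (E (Fin.tail s)).2) (hd _ (E (Fin.tail s')).2)
    · exact absurd (h ▸ (E (Fin.tail s')).2) (hd _ (E (Fin.tail s)).2)
    · exact ⟨(h01 _ h0).trans (h01 _ h0').symm, E.injective (Subtype.ext (τ.injective h))⟩
  obtain ⟨c, hc, h1, h2⟩ := exists_circuit_pairing hm hn p hp
  refine ⟨c, hc, fun a ha => ?_, fun x hx hx' => h2 x fun s hs => ?_⟩
  · have hp0 : p (Fin.cons 0 (E.symm ⟨a, ha⟩)) = a := by simp [p]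
    have hp1 : p (Fin.cons 1 (E.symm ⟨a, ha⟩)) = τ a := by simp [p]
    constructor
    · conv_lhs => rw [← hp0]
      rw [h1, ← hp1]
      simp
    · conv_lhs => rw [← hp1]
      rw [h1]
      conv_rhs => rw [← hp0]
      simp [CharTwo.add_self_eq_zero]
  · by_cases h0 : s 0 = 0
    · refine hx ?_
      rw [hs]; simp [p, h0]
    · refine hx' ?_
      rw [hs]; simp [p, h0]

/-! ### Even permutations -/

theorem Computes.mul {σ τ : Equiv.Perm (BVec n)} {k l : ℕ} (hσ : Computes σ k)
    (hτ : Computes τ l) : Computes (σ * τ : Equiv.Perm (BVec n)) (k + l) :=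
  ((hσ.comp hτ).mono (Nat.add_comm l k).le).congr fun _ => rfl

theorem Computes.inv {σ : Equiv.Perm (BVec n)} {k : ℕ} (hσ : Computes σ k) :
    Computes (σ⁻¹ : Equiv.Perm (BVec n)) k := by
  obtain ⟨c, hc, h⟩ := hσ
  refine ⟨c.reverse, by simpa using hc, fun x => ?_⟩
  rw [Equiv.Perm.eq_inv_iff_eq, ← h, Circuit.eval_eval_reverse]

/-- A product of two disjoint transpositions. -/
theorem computes_swap_mul_swap_of_disjoint (hn : 18 ≤ n) {a b c d : BVec n} (hab : a ≠ b)
    (hcd : c ≠ d) (hac : a ≠ c) (had : a ≠ d) (hbc : b ≠ c) (hbd : b ≠ d) :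
    Computes (Equiv.swap a b * Equiv.swap c d : Equiv.Perm (BVec n)) (groupCost n 1) := by
  classical
  have ha : (Equiv.swap a b * Equiv.swap c d) a = b := by
    rw [Equiv.Perm.mul_apply, Equiv.swap_apply_of_ne_of_ne hac had, Equiv.swap_apply_left]
  have hc : (Equiv.swap a b * Equiv.swap c d) c = d := by
    rw [Equiv.Perm.mul_apply, Equiv.swap_apply_left, Equiv.swap_apply_of_ne_of_ne had.symm hbd.symm]
  have hb : (Equiv.swap a b * Equiv.swap c d) b = a := by
    rw [Equiv.Perm.mul_apply, Equiv.swap_apply_of_ne_of_ne hbc hbd, Equiv.swap_apply_right]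
  have hd : (Equiv.swap a b * Equiv.swap c d) d = c := by
    rw [Equiv.Perm.mul_apply, Equiv.swap_apply_right, Equiv.swap_apply_of_ne_of_ne hac.symm hbc.symm]
  obtain ⟨C, hC, h1, h2⟩ := exists_circuit_swaps (m := 1) le_rfl (by norm_num; omega) {a, c}
    (Equiv.swap a b * Equiv.swap c d) (Finset.card_pair hac) (by
      simp only [Finset.mem_insert, Finset.mem_singleton, forall_eq_or_imp, forall_eq, ha, hc]
      exact ⟨by simp [hab.symm, hbc], by simp [hcd.symm, had.symm]⟩)
  simp only [Finset.mem_insert, Finset.mem_singleton, forall_eq_or_imp, forall_eq, ha, hc] at h1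
  refine ⟨C, hC, fun x => ?_⟩
  by_cases hxa : x = a
  · rw [hxa, ha, h1.1.1]
  by_cases hxb : x = b
  · rw [hxb, hb, h1.1.2]
  by_cases hxc : x = c
  · rw [hxc, hc, h1.2.1]
  by_cases hxd : x = d
  · rw [hxd, hd, h1.2.2]
  have hx : (Equiv.swap a b * Equiv.swap c d) x = x := by
    rw [Equiv.Perm.mul_apply, Equiv.swap_apply_of_ne_of_ne hxc hxd,
      Equiv.swap_apply_of_ne_of_ne hxa hxb]
  have hx' : (Equiv.swap a b * Equiv.swap c d).symm x = x := by
    rw [Equiv.symm_apply_eq, hx]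
  rw [hx]
  exact h2 x (by simp [hxa, hxc]) (by rw [hx']; simp [hxa, hxc])

/-- A product of two arbitrary transpositions. -/
theorem computes_swap_mul_swap (hn : 18 ≤ n) {a b c d : BVec n} (hab : a ≠ b) (hcd : c ≠ d) :
    Computes (Equiv.swap a b * Equiv.swap c d : Equiv.Perm (BVec n)) (2 * groupCost n 1) := by
  classical
  have hcard : ({a, b, c, d} : Finset (BVec n)).card ≤ 4 := Finset.card_le_four
  have hbig : Fintype.card (BVec n) ≥ 2 ^ 4 := by
    simp only [Fintype.card_fun, ZMod.card, Fintype.card_fin]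
    exact Nat.pow_le_pow_right (by norm_num) (by omega)
  -- Inserting `swap u v` twice, with `u`, `v` away from all four points, reduces to two products of
  -- disjoint transpositions.
  obtain ⟨u, hu, v, hv, huv⟩ := Finset.one_lt_card.1
    (show 1 < ({a, b, c, d} : Finset (BVec n))ᶜ.card by rw [Finset.card_compl]; omega)
  simp only [Finset.mem_compl, Finset.mem_insert, Finset.mem_singleton, not_or] at hu hv
  have h1 := computes_swap_mul_swap_of_disjoint hn hab huv (Ne.symm hu.1) (Ne.symm hv.1)
    (Ne.symm hu.2.1) (Ne.symm hv.2.1)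
  have h2 := computes_swap_mul_swap_of_disjoint hn huv hcd hu.2.2.1 hu.2.2.2 hv.2.2.1 hv.2.2.2
  have h3 := h1.mul h2
  rw [mul_assoc, ← mul_assoc (Equiv.swap u v), Equiv.swap_mul_self, one_mul] at h3
  exact h3.mono (by omega)

/-- An even permutation of small support. -/
theorem computes_of_card_support_le (hn : 18 ≤ n) (j : ℕ) (σ : Equiv.Perm (BVec n))
    (hσ : Equiv.Perm.sign σ = 1) (hj : σ.support.card ≤ j) :
    Computes σ (j * groupCost n 1) := by
  induction j using Nat.strong_induction_on generalizing σ with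
  | _ j ih =>
    by_cases h1 : σ = 1
    · subst h1
      exact ((Computes.id n).mono (Nat.zero_le _)).congr fun _ => rfl
    obtain ⟨x, hx⟩ : ∃ x, σ x ≠ x := by
      by_contra! h; exact h1 (Equiv.ext h)
    have hl := Equiv.Perm.card_support_swap_mul hx
    set τ := Equiv.swap x (σ x) * σ with hτ
    have hs : Equiv.Perm.sign τ = -1 := by
      rw [hτ, Equiv.Perm.sign_mul, Equiv.Perm.sign_swap hx.symm, hσ, mul_one]
    -- After one transposition the permutation is odd, hence not the identity. Two transpositions
    -- thus remove at least two points of the support for `2 * groupCost n 1`.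
    obtain ⟨y, hy⟩ : ∃ y, τ y ≠ y := by
      by_contra! h
      rw [show τ = 1 from Equiv.ext h, Equiv.Perm.sign_one] at hs
      exact absurd hs (by decide)
    have hl' := Equiv.Perm.card_support_swap_mul hy
    set ρ := Equiv.swap y (τ y) * τ with hρ
    have hs' : Equiv.Perm.sign ρ = 1 := by
      rw [hρ, Equiv.Perm.sign_mul, Equiv.Perm.sign_swap hy.symm, hs]; decide
    obtain ⟨i, rfl⟩ : ∃ i, j = i + 2 := ⟨j - 2, by omega⟩
    have h2 := (computes_swap_mul_swap hn hx.symm hy.symm).mul (ih i (by omega) ρ hs' (by omega))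
    have he : σ = Equiv.swap x (σ x) * Equiv.swap y (τ y) * ρ := by
      rw [hρ, mul_assoc, Equiv.swap_mul_self_mul, hτ, Equiv.swap_mul_self_mul]
    rw [← he] at h2
    exact h2.mono (by ring_nf; rfl)

/-- A permutation with large support moves many points off each other. -/
theorem exists_finset_disjoint_image {α : Type*} [Fintype α] [DecidableEq α] (σ : Equiv.Perm α)
    {k : ℕ} (hk : 3 * k ≤ σ.support.card) :
    ∃ A ⊆ σ.support, A.card = k ∧ ∀ a ∈ A, σ a ∉ A := by
  induction k with
  | zero => exact ⟨∅, by simp, rfl, by simp⟩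
  | succ k ih =>
    obtain ⟨A, hA, hAk, hd⟩ := ih (by omega)
    have h1 : (A.image σ).card ≤ A.card := Finset.card_image_le
    have h2 : (A.image σ.symm).card ≤ A.card := Finset.card_image_le
    -- Greedy choice: a new point must avoid `A` and its images under `σ` and `σ.symm`, at most `3 *
    -- k` points.
    have h3 : (A ∪ A.image σ ∪ A.image σ.symm).card < σ.support.card := by
      have := Finset.card_union_le (A ∪ A.image σ) (A.image σ.symm)
      have := Finset.card_union_le A (A.image σ)
      omega
    obtain ⟨x, hx, hxA⟩ := Finset.exists_mem_notMem_of_card_lt_card h3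
    simp only [Finset.mem_union, not_or, Finset.mem_image, not_exists, not_and] at hxA
    obtain ⟨⟨hx1, hx2⟩, hx3⟩ := hxA
    refine ⟨insert x A, Finset.insert_subset hx hA, by rw [Finset.card_insert_of_notMem hx1, hAk],
      fun a ha => ?_⟩
    rw [Finset.mem_insert, not_or]
    rcases Finset.mem_insert.1 ha with rfl | ha
    · exact ⟨Equiv.Perm.mem_support.1 hx, fun h => hx3 _ h (σ.symm_apply_apply a)⟩
    · exact ⟨hx2 a ha, hd a ha⟩

/-- The number of gates for an even permutation, in terms of the size of its support. -/
theorem computes_of_sign_eq_one {m : ℕ} (hm : 1 ≤ m) (hn : 2 ^ 2 ^ (m + 1) + (m + 1) ≤ n) (q : ℕ)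
    (σ : Equiv.Perm (BVec n)) (hσ : Equiv.Perm.sign σ = 1) (hq : σ.support.card ≤ q * 2 ^ m) :
    Computes σ (q * groupCost n m + 3 * 2 ^ m * groupCost n 1) := by
  have h4 : 2 ^ 2 ^ (1 + 1) ≤ 2 ^ 2 ^ (m + 1) :=
    Nat.pow_le_pow_right (by norm_num) (Nat.pow_le_pow_right (by norm_num) (by omega))
  have hn18 : 18 ≤ n := by norm_num at h4; omega
  induction q generalizing σ with
  | zero =>
    exact (computes_of_card_support_le hn18 0 σ hσ (by omega)).mono (by simp)
  | succ q ih =>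
    rcases lt_or_ge σ.support.card (3 * 2 ^ m) with hlt | hge
    · exact (computes_of_card_support_le hn18 _ σ hσ hlt.le).mono (Nat.le_add_left _ _)
    obtain ⟨A, hA, hAc, hd⟩ := exists_finset_disjoint_image σ hge
    obtain ⟨c, hc, h1, h2⟩ := exists_circuit_swaps hm hn A σ hAc hd
    have hcomp : Computes c.perm (groupCost n m) := ⟨c, hc, fun _ => rfl⟩
    -- `c` sends `σ a` back to `a`, so the product fixes all of `A`, and it moves no point that `σ`
    -- fixes.
    have hsupp : (c.perm * σ).support ⊆ σ.support \ A := by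
      intro x hx
      rw [Equiv.Perm.mem_support, Equiv.Perm.mul_apply, Circuit.perm_apply] at hx
      rw [Finset.mem_sdiff, Equiv.Perm.mem_support]
      have hxA : x ∉ A := fun h => hx (h1 x h).2
      refine ⟨fun h => hx ?_, hxA⟩
      rw [h]
      exact h2 x hxA (by rwa [σ.symm_apply_eq.2 h.symm])
    have hcard := Finset.card_le_card hsupp
    rw [Finset.card_sdiff_of_subset hA, hAc] at hcard
    have h3 := hcomp.inv.mul (ih (c.perm * σ)
      (by rw [Equiv.Perm.sign_mul, hσ, Circuit.sign_perm (by omega), one_mul])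
      (by rw [add_mul, one_mul] at hq; omega))
    rw [inv_mul_cancel_left] at h3
    exact h3.mono (by rw [add_mul, one_mul]; omega)

/-! ### Bounds for the Shannon function -/

/-- Output permutations are free: a shorter circuit for the same transformation realizes the same
map with the same `π`. -/
theorem shannonComplexity_le {B : ℕ} (h : ∀ c : Circuit n, Computes c.eval B) :
    shannonComplexity n 0 ≤ B := by
  obtain ⟨f, ⟨c, π, hc⟩, hf⟩ := (shannonComplexity_isGreatest n 0).1
  obtain ⟨d, hd, hdc⟩ := h c
  rw [← hf]
  have hr : Realizes (q := 0) d f := ⟨π, fun x j => by rw [← hc x j]; exact congrFun (hdc _) _⟩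
  exact ((mapComplexity_isLeast (q := 0) ⟨c, π, hc⟩).2 ⟨d, hr, rfl⟩).trans hd

theorem shannonComplexity_le_of_groups {m : ℕ} (hm : 1 ≤ m)
    (hn : 2 ^ 2 ^ (m + 1) + (m + 1) ≤ n) :
    shannonComplexity n 0 ≤ 2 ^ (n - m) * groupCost n m + 3 * 2 ^ m * groupCost n 1 := by
  have h4 : 2 ^ 2 ^ (1 + 1) ≤ 2 ^ 2 ^ (m + 1) :=
    Nat.pow_le_pow_right (by norm_num) (Nat.pow_le_pow_right (by norm_num) (by omega))
  norm_num at h4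
  refine shannonComplexity_le fun c => ?_
  refine computes_of_sign_eq_one hm hn (2 ^ (n - m)) c.perm (c.sign_perm (by omega)) ?_
  rw [← pow_add, Nat.sub_add_cancel (by omega)]
  exact (Finset.card_le_univ _).trans (by simp [ZMod.card])

/-- A shortest circuit passes through pairwise distinct permutations. -/
theorem computes_card_perm (c : Circuit n) :
    Computes c.eval (Fintype.card (Equiv.Perm (BVec n))) := by
  classical
  obtain ⟨d, hd, hmin⟩ : ∃ d : Circuit n, d.eval = c.eval ∧
      ∀ d' : Circuit n, d'.eval = c.eval → d.length ≤ d'.length := by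
    obtain ⟨d, hd, hmin⟩ := WellFounded.has_min (measure (List.length (α := Gate n))).wf
      {d | Circuit.eval d = c.eval} ⟨c, rfl⟩
    exact ⟨d, hd, fun d' h' => not_lt.1 (hmin d' h')⟩
  refine ⟨d, ?_, fun x => congrFun hd x⟩
  by_contra! hlt
  obtain ⟨i, j, hij, he⟩ := Fintype.exists_ne_map_eq_of_card_lt
    (fun i : Fin d.length => Circuit.perm (d.take i)) (by simpa using hlt)
  wlog hlt' : i < j generalizing i j
  · exact this j i hij.symm he.symm (lt_of_le_of_ne (not_lt.1 hlt') hij.symm)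
  -- Equal prefixes allow the gates between them to be cut out, contradicting minimality.
  have h1 : Circuit.eval (d.take i ++ d.drop j) = c.eval := by
    rw [← hd]
    funext x
    conv_rhs => rw [← List.take_append_drop j d]
    rw [Circuit.eval_append, Circuit.eval_append]
    have := Equiv.congr_fun he x
    simp only [Circuit.perm_apply] at this
    rw [this]
  have h2 := hmin _ h1
  rw [List.length_append, List.length_take, List.length_drop] at h2
  have := j.2
  omega

/-- There are `4! = 24` permutations of the four points. -/
theorem shannonComplexity_two_le : shannonComplexity 2 0 ≤ 24 := by
  refine shannonComplexity_le fun c => (computes_card_perm c).mono ?_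
  rw [Fintype.card_perm]
  simp [ZMod.card, Nat.factorial]

/-! ### Choice of the group size -/

/-- Here `107916 = 204 * 23 ^ 2`, and `27 = 324 / 12`, as needed for `r = l / 12` in
`exists_group_size`. -/
theorem mul_sq_le_two_pow {r : ℕ} (hr : 27 ≤ r) : 107916 * r ^ 2 ≤ 2 ^ r := by
  induction r, hr using Nat.le_induction with
  | base => norm_num
  | succ r hr ih =>
    rw [pow_succ 2 r]
    nlinarith

theorem exists_group_size {n : ℕ} (hn : 324 ≤ Nat.log 2 n) :
    ∃ m, 1 ≤ m ∧ 2 ^ 2 ^ (m + 1) + (m + 1) ≤ n ∧ 2 * groupCost n m ≤ 21 * n ∧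
      11 * Nat.log 2 n < 48 * 2 ^ m ∧ 2 ^ m ≤ Nat.log 2 n ∧ 204 * Nat.log 2 n ^ 2 ≤ n := by
  have hn0 : n ≠ 0 := by rintro rfl; simp at hn
  have hle : 2 ^ Nat.log 2 n ≤ n := Nat.pow_log_le_self 2 hn0
  generalize Nat.log 2 n = l at *
  -- Taking `2 ^ (m + 1)` at most `11 / 12` of `log₂ n` keeps `2 ^ 2 ^ (m + 1)` below `n ^ (11 /
  -- 12)`, so the terms beyond `10 * n` fit into `n / 2`. Rounding to a power of two loses at most a
  -- factor `2`, whence `48 / 11`.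
  obtain ⟨q, hq⟩ : ∃ q, q = 11 * l / 12 := ⟨_, rfl⟩
  have hq0 : q ≠ 0 := by omega
  obtain ⟨m, hm1, hs, hs'⟩ : ∃ m, 1 ≤ m ∧ 2 ^ (m + 1) ≤ q ∧ q < 2 ^ (m + 2) := by
    have h1 : 2 ≤ Nat.log 2 q := Nat.le_log_of_pow_le (by norm_num) (by omega)
    refine ⟨Nat.log 2 q - 1, by omega, ?_, ?_⟩
    · rw [Nat.sub_add_cancel (by omega)]
      exact Nat.pow_log_le_self 2 hq0
    · rw [show Nat.log 2 q - 1 + 2 = Nat.log 2 q + 1 by omega]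
      exact Nat.lt_pow_succ_log_self (by norm_num) q
  have hD : 2 ^ 2 ^ (m + 1) ≤ 2 ^ q := Nat.pow_le_pow_right (by norm_num) hs
  have hr := mul_sq_le_two_pow (r := l / 12) (by omega)
  have hlr : l ≤ 23 * (l / 12) := by omega
  -- `204 = 24 + 180` covers twice the lower-order terms of `groupCost`.
  have hbig : 204 * (l ^ 2 * 2 ^ q) ≤ n := by
    calc 204 * (l ^ 2 * 2 ^ q) ≤ 204 * ((23 * (l / 12)) ^ 2 * 2 ^ q) := by gcongr
      _ = 107916 * (l / 12) ^ 2 * 2 ^ q := by ring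
      _ ≤ 2 ^ (l / 12) * 2 ^ q := by gcongr
      _ = 2 ^ (l / 12 + q) := (pow_add _ _ _).symm
      _ ≤ 2 ^ l := Nat.pow_le_pow_right (by norm_num) (by omega)
      _ ≤ n := hle
  have hm2 : m + 1 < 2 ^ (m + 1) := Nat.lt_two_pow_self
  have hsl : 2 ^ (m + 1) ≤ l := hs.trans (by omega)
  have hl2 : l ≤ l ^ 2 := Nat.le_self_pow (by norm_num) l
  have hlq : l ^ 2 ≤ l ^ 2 * 2 ^ q := Nat.le_mul_of_pos_right _ (Nat.two_pow_pos q)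
  have hqq : 2 ^ q ≤ l ^ 2 * 2 ^ q := Nat.le_mul_of_pos_left _ (by omega)
  have hsq : (2 ^ (m + 1)) ^ 2 * 2 ^ 2 ^ (m + 1) ≤ l ^ 2 * 2 ^ q :=
    Nat.mul_le_mul (Nat.pow_le_pow_left hsl 2) hD
  refine ⟨m, hm1, by omega, ?_, ?_, ?_, by omega⟩
  · rw [groupCost, mul_assoc 90]
    omega
  · rw [pow_add] at hs'
    omega
  · rw [pow_succ] at hsl
    omega

/-- The constants give `(21 / 2) * (48 / 11) < 46`; the slack up to `48` absorbs `l + 1` in place of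
`l` and the leftover permutations. -/
theorem shannonComplexity_mul_le {n : ℕ} (hn : 324 ≤ Nat.log 2 n) :
    shannonComplexity n 0 * (Nat.log 2 n + 1) ≤ 48 * n * 2 ^ n := by
  obtain ⟨m, hm1, hmn, hG, hK, hml, hln⟩ := exists_group_size hn
  have hL := shannonComplexity_le_of_groups hm1 hmn
  generalize Nat.log 2 n = l at *
  have hG1 : groupCost n 1 ≤ groupCost n m := by
    have h1 : 2 ^ (1 + 1) ≤ 2 ^ (m + 1) := Nat.pow_le_pow_right (by norm_num) (by omega)
    have h2 : 2 ^ 2 ^ (1 + 1) ≤ 2 ^ 2 ^ (m + 1) := Nat.pow_le_pow_right (by norm_num) h1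
    exact Nat.add_le_add_left
      (Nat.mul_le_mul (Nat.mul_le_mul_left 90 (Nat.pow_le_pow_left h1 2)) h2) _
  have hmn' : m ≤ n := (Nat.le_succ m).trans (le_of_add_le_right hmn)
  have hpow : 2 ^ (n - m) * 2 ^ m = 2 ^ n := by rw [← pow_add, Nat.sub_add_cancel hmn']
  have h1 : (l + 1) * 21 * 2 ^ (n - m) ≤ 95 * 2 ^ n := by
    have : (l + 1) * 21 ≤ 95 * 2 ^ m := by omega
    calc (l + 1) * 21 * 2 ^ (n - m) ≤ 95 * 2 ^ m * 2 ^ (n - m) := by gcongr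
      _ = 95 * 2 ^ n := by rw [← hpow]; ring
  have h2 : (l + 1) * 63 * 2 ^ m ≤ 2 ^ n := by
    have hlt : n < 2 ^ n := Nat.lt_two_pow_self
    calc (l + 1) * 63 * 2 ^ m ≤ (l + l) * 63 * l := by gcongr; omega
      _ = 126 * l ^ 2 := by ring
      _ ≤ 2 ^ n := by omega
  have h3 : 2 * shannonComplexity n 0 ≤ 21 * n * (2 ^ (n - m) + 3 * 2 ^ m) := by
    calc 2 * shannonComplexity n 0
        ≤ 2 * (2 ^ (n - m) * groupCost n m + 3 * 2 ^ m * groupCost n m) := by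
          gcongr
          exact hL.trans (by gcongr)
      _ = 2 * groupCost n m * (2 ^ (n - m) + 3 * 2 ^ m) := by ring
      _ ≤ _ := by gcongr
  refine Nat.le_of_mul_le_mul_left ?_ (show 0 < 2 by norm_num)
  calc 2 * (shannonComplexity n 0 * (l + 1)) = 2 * shannonComplexity n 0 * (l + 1) := by ring
    _ ≤ 21 * n * (2 ^ (n - m) + 3 * 2 ^ m) * (l + 1) := by gcongr
    _ = n * ((l + 1) * 21 * 2 ^ (n - m) + (l + 1) * 63 * 2 ^ m) := by ring
    _ ≤ n * (95 * 2 ^ n + 2 ^ n) := by gcongr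
    _ = 2 * (48 * n * 2 ^ n) := by ring

theorem shannonComplexity_mul_logb_le {n : ℕ} (hn : 324 ≤ Nat.log 2 n) :
    (shannonComplexity n 0 : ℝ) * Real.logb 2 n ≤ 3 * n * 2 ^ (n + 4) := by
  have hn0 : n ≠ 0 := by rintro rfl; simp at hn
  have h1 : ((shannonComplexity n 0 * (Nat.log 2 n + 1) : ℕ) : ℝ) ≤ (48 * n * 2 ^ n : ℕ) :=
    Nat.cast_le.2 (shannonComplexity_mul_le hn)
  push_cast at h1
  have h2 : Real.logb 2 n ≤ Nat.log 2 n + 1 := by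
    rw [Real.logb_le_iff_le_rpow (by norm_num) (by positivity)]
    have := (Nat.lt_pow_succ_log_self (b := 2) (by norm_num) n).le
    exact_mod_cast this
  calc _ ≤ (shannonComplexity n 0 : ℝ) * (Nat.log 2 n + 1) := by gcongr
    _ ≤ 48 * n * 2 ^ n := h1
    _ = _ := by ring

/-! ### Logarithmic estimates and the case of two wires -/

theorem logb_two_le_self {x : ℝ} (hx : 0 < x) : Real.logb 2 x ≤ x := by
  have h1 := Real.log_le_sub_one_of_pos (half_pos hx)
  rw [Real.log_div hx.ne' (by norm_num)] at h1
  have h2 := Real.log_two_gt_d9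
  have h3 := Real.log_two_lt_d9
  rw [Real.logb, div_le_iff₀ (by linarith)]
  nlinarith

theorem one_le_logb_two {n : ℕ} (hn : 2 ≤ n) : 1 ≤ Real.logb 2 n := by
  rw [Real.le_logb_iff_rpow_le (by norm_num) (by positivity)]
  simpa using (Nat.cast_le (α := ℝ)).2 hn

theorem tendsto_logb_mul_logb_logb_div :
    Tendsto (fun n : ℕ => Real.logb 2 n * Real.logb 2 (Real.logb 2 n) / n) atTop (𝓝 0) := by
  have hlog : 0 < Real.log 2 := Real.log_pos (by norm_num)
  have h0 : Tendsto (fun x : ℝ => Real.logb 2 x ^ 2 / x) atTop (𝓝 0) := by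
    have h := (Real.isLittleO_pow_log_id_atTop (n := 2)).tendsto_div_nhds_zero
    have h' := h.const_mul ((Real.log 2 ^ 2)⁻¹)
    rw [mul_zero] at h'
    refine h'.congr fun x => ?_
    simp only [Real.logb, id]
    field_simp
  refine squeeze_zero' ?_ ?_ (h0.comp tendsto_natCast_atTop_atTop)
  · filter_upwards [eventually_ge_atTop 2] with n hn
    have h1 := one_le_logb_two hn
    have := Real.logb_nonneg (b := 2) (by norm_num) h1
    positivity
  · filter_upwards [eventually_ge_atTop 2] with n hn
    have h1 := one_le_logb_two hn
    have h2 : Real.logb 2 (Real.logb 2 n) ≤ Real.logb 2 n := logb_two_le_self (by linarith)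
    simp only [Function.comp]
    rw [sq]
    gcongr

theorem eventually_le_log_two (k : ℕ) : ∀ᶠ n in atTop, k ≤ Nat.log 2 n := by
  filter_upwards [eventually_ge_atTop (2 ^ k)] with n hn
  exact Nat.le_log_of_pow_le (by norm_num) hn

theorem shannonComplexity_two_le_bound {t : ℝ} (h0 : 0 < t) (h2 : t < 2) :
    (shannonComplexity 2 0 : ℝ) ≤ 384 / (1 - Real.logb 2 t) * (1 + 1 / (6 * t)) := by
  have h24 : (shannonComplexity 2 0 : ℝ) ≤ 24 := by exact_mod_cast shannonComplexity_two_le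
  refine h24.trans ?_
  have h1 : Real.logb 2 (2 / t) = 1 - Real.logb 2 t := by
    rw [Real.logb_div (by norm_num) h0.ne', Real.logb_self_eq_one (by norm_num)]
  have hpos : 0 < Real.logb 2 (2 / t) :=
    Real.logb_pos (by norm_num) (by rwa [lt_div_iff₀ h0, one_mul])
  have hle : Real.logb 2 (2 / t) ≤ 2 / t := logb_two_le_self (by positivity)
  rw [← h1, div_mul_eq_mul_div, le_div_iff₀ hpos]
  calc 24 * Real.logb 2 (2 / t) ≤ 24 * (2 / t) := by gcongr
    _ ≤ 384 * (1 + 1 / (6 * t)) := by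
      have : 24 * (2 / t) = 288 * (1 / (6 * t)) := by field_simp; norm_num
      have : 0 < 1 / (6 * t) := by positivity
      linarith

end RevCircuit

theorem mainTheorem4 (φ : ℕ → ℝ) (hφ : Tendsto φ atTop atTop) :
    ∃ δ : ℕ → ℝ, Tendsto δ atTop (𝓝 0) ∧ (∀ᶠ n in atTop, 0 ≤ δ n) ∧
      Tendsto (RevCircuit.epsilon φ δ) atTop (𝓝 0) ∧
      ∀ n : ℕ, 2 ≤ n → 0 < φ n → φ n < n / Real.logb 2 n →
        (RevCircuit.shannonComplexity n 0 : ℝ) ≤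
          3 * n * 2 ^ (n + 4) /
              (Real.logb 2 n - Real.logb 2 (Real.logb 2 n) - Real.logb 2 (φ n)) *
            (1 + RevCircuit.epsilon φ δ n) := by
  classical
  obtain ⟨N, hN⟩ := eventually_atTop.1 (hφ.eventually_ge_atTop 1)
  let a : ℕ → ℝ := fun n => 3 * n * 2 ^ (n + 4) /
    (Real.logb 2 n - Real.logb 2 (Real.logb 2 n) - Real.logb 2 (φ n))
  let b : ℕ → ℝ := fun n => Real.logb 2 n * Real.logb 2 (Real.logb 2 n) / n
  -- For the finitely many exceptional `n`, `δ` is chosen so that `a n * (8 / 3 - δ n) * b n` equals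
  -- the complexity itself, provided `a n` and `b n` are nonzero.
  let δ : ℕ → ℝ := fun n => if N ≤ n ∧ 324 ≤ Nat.log 2 n then 0 else
    8 / 3 - RevCircuit.shannonComplexity n 0 / a n / b n
  have hδ : δ =ᶠ[atTop] fun _ => 0 := by
    filter_upwards [eventually_ge_atTop N, RevCircuit.eventually_le_log_two 324] with n h1 h2
    exact if_pos ⟨h1, h2⟩
  have hδ0 : Tendsto δ atTop (𝓝 0) := tendsto_const_nhds.congr' hδ.symm
  refine ⟨δ, hδ0, hδ.mono fun n hn => hn.ge, ?_, fun n hn h0 hlt => ?_⟩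
  · have h1 : Tendsto (fun n => 1 / (6 * φ n)) atTop (𝓝 0) := by
      simp only [one_div]
      exact tendsto_inv_atTop_zero.comp (hφ.const_mul_atTop (by norm_num))
    have h2 := ((tendsto_const_nhds (x := (8 / 3 : ℝ))).sub hδ0).mul
      RevCircuit.tendsto_logb_mul_logb_logb_div
    have h3 := h1.add h2
    rwa [mul_zero, add_zero] at h3
  have hn0 : (0 : ℝ) < n := by positivity
  have hl1 : 1 ≤ Real.logb 2 n := RevCircuit.one_le_logb_two hn
  have hl0 : 0 < Real.logb 2 n := by linarith
  have hll : 0 ≤ Real.logb 2 (Real.logb 2 n) := Real.logb_nonneg (by norm_num) hl1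
  -- The condition `φ n < n / log₂ n` says exactly that the denominator is positive.
  have hden : 0 < Real.logb 2 n - Real.logb 2 (Real.logb 2 n) - Real.logb 2 (φ n) := by
    have := Real.logb_lt_logb (b := 2) (by norm_num) h0 hlt
    rw [Real.logb_div hn0.ne' hl0.ne'] at this
    linarith
  have ha : 0 < a n := by positivity
  have hφ0 : 0 < 1 / (6 * φ n) := by positivity
  change _ ≤ a n * (1 + (1 / (6 * φ n) + (8 / 3 - δ n) * b n))
  by_cases hbig : N ≤ n ∧ 324 ≤ Nat.log 2 n
  · have hδn : δ n = 0 := if_pos hbig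
    have hφ1 : 0 ≤ Real.logb 2 (φ n) := Real.logb_nonneg (by norm_num) (hN n hbig.1)
    -- Since `φ n ≥ 1`, the denominator is at most `log₂ n`, so the main term alone suffices.
    have hLa : (RevCircuit.shannonComplexity n 0 : ℝ) ≤ a n := by
      rw [le_div_iff₀ hden]
      refine le_trans ?_ (RevCircuit.shannonComplexity_mul_logb_le hbig.2)
      gcongr
      linarith
    have hb : 0 ≤ b n := by positivity
    rw [hδn]
    nlinarith [mul_nonneg ha.le hb, mul_pos ha hφ0]
  -- At `n = 2` the factor `b n` is `0`, so `δ` has no influence and the term `1 / (6 * φ n)` must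
  -- do the work when `φ n` is small.
  · rcases hn.eq_or_lt with rfl | hn3
    · have := RevCircuit.shannonComplexity_two_le_bound h0 (by simpa using hlt)
      norm_num [a, b] at this ⊢
      exact this
    · have hl1' : 1 < Real.logb 2 n := by
        rw [Real.lt_logb_iff_rpow_lt (by norm_num) hn0]
        simpa using (Nat.cast_lt (α := ℝ)).2 hn3
      have hb : 0 < b n := div_pos (mul_pos hl0 (Real.logb_pos (by norm_num) hl1')) hn0
      have hδn : (8 / 3 - δ n) * b n = RevCircuit.shannonComplexity n 0 / a n := by
        simp only [δ, if_neg hbig, sub_sub_cancel]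
        field_simp
      rw [hδn, mul_add, mul_add, mul_div_cancel₀ _ ha.ne']
      nlinarith [mul_pos ha hφ0]
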